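/- Let $d\ge 1$ and let $\mathcal M$ be a small $d$-abelian category: an additive, idempotent complete category in which every morphism has a $d$-kernel and a $d$-cokernel, every monomorphism followed by any of its $d$-cokernels is a $d$-exact sequence, and every epimorphism preceded by any of its $d$-kernels is a $d$-exact sequence. Here a sequence $X^0\to X^1\to\cdots\to X^{d+1}$ in $\mathcal M$ is right $d$-exact (that is, $X^1\to\cdots\to X^{d+1}$ is a $d$-cokernel of $X^0\to X^1$) if $$0\to\operatorname{Hom}(X^{d+1},Y)\to\cdots\to\operatorname{Hom}(X^1,Y)\to\operatorname{Hom}(X^0,Y)$$ is exact for every $Y\in\mathcal M$; left $d$-exact sequences and $d$-kernels are defined dually, and a sequence is $d$-exact if it is both left and right $d$-exact. Let $\operatorname{Mod}\mathcal M$ be the category of additive contravariant functors from $\mathcal M$ to abelian groups, and consider its full subcategories - $\operatorname{Ind}(\mathcal M)$, of all filtered colimits of representable functors; - $\operatorname{Flat}(\mathcal M)$, of all $F$ such that $F\otimes_{\mathcal M}-$ is exact on additive covariant functors from $\mathcal M$ to abelian groups; - $\mathcal L_d(\mathcal M)$, of all left $d$-exact functors, that is, of all $F$ such that $0\to F(X^{d+1})\to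 F(X^d)\to\cdots\to F(X^1)\to F(X^0)$ is exact for every right $d$-exact sequence $X^0\to\cdots\to X^{d+1}$ in $\mathcal M$. Then $\operatorname{Ind}(\mathcal M)=\mathcal L_d(\mathcal M)$ and $\operatorname{Ind}(\mathcal M)=\operatorname{Flat}(\mathcal M)$. Moreover, $F\in\operatorname{Mod}\mathcal M$ already lies in $\mathcal L_d(\mathcal M)$ if $0\to F(X^{d+1})\to\cdots\to F(X^1)\to F(X^0)$ is exact for every $d$-exact sequence $X^0\to\cdots\to X^{d+1}$ in $\mathcal M$. -/

import Mathlib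

open CategoryTheory CategoryTheory.Limits Opposite
open scoped TensorProduct DirectSum

universe w v u

namespace DAbelian

section Sequences

variable {C : Type u} [Category.{v} C] [Preadditive C]

/-- For a sequence `X⁰ ⟶ X¹ ⟶ ⋯ ⟶ Xᵈ⁺¹` and a contravariant functor `F` to abelian groups:
the sequence `0 ⟶ F(Xᵈ⁺¹) ⟶ F(Xᵈ) ⟶ ⋯ ⟶ F(X¹) ⟶ F(X⁰)` is exact. -/
def IsLeftExactOn (F : Cᵒᵖ ⥤ AddCommGrpCat.{w}) {d : ℕ} (S : ComposableArrows C (d + 1)) : Prop :=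
  Function.Injective (F.map (S.map' d (d + 1)).op) ∧
    ∀ (k : ℕ) (hk : k < d),
      Function.Exact (F.map (S.map' (k + 1) (k + 2)).op) (F.map (S.map' k (k + 1)).op)

/-- For a sequence `X⁰ ⟶ X¹ ⟶ ⋯ ⟶ Xᵈ⁺¹` and a covariant functor `G` to abelian groups:
the sequence `0 ⟶ G(X⁰) ⟶ G(X¹) ⟶ ⋯ ⟶ G(Xᵈ) ⟶ G(Xᵈ⁺¹)` is exact. -/
def IsCoLeftExactOn (G : C ⥤ AddCommGrpCat.{w}) {d : ℕ} (S : ComposableArrows C (d + 1)) : Prop :=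
  Function.Injective (G.map (S.map' 0 1)) ∧
    ∀ (k : ℕ) (hk : k < d),
      Function.Exact (G.map (S.map' k (k + 1))) (G.map (S.map' (k + 1) (k + 2)))

/-- Right `d`-exact sequences `X⁰ ⟶ X¹ ⟶ ⋯ ⟶ Xᵈ⁺¹`: the morphisms `(α¹, …, αᵈ)` form a
`d`-cokernel of `α⁰`, i.e. `0 ⟶ Hom(Xᵈ⁺¹, Y) ⟶ ⋯ ⟶ Hom(X¹, Y) ⟶ Hom(X⁰, Y)` is exact for all `Y`.
(For `d ≥ 1` such a sequence is a complex.) -/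
def IsRightDExact {d : ℕ} (S : ComposableArrows C (d + 1)) : Prop :=
  ∀ Y : C, IsLeftExactOn (preadditiveYoneda.obj Y) S

/-- Left `d`-exact sequences `X⁰ ⟶ X¹ ⟶ ⋯ ⟶ Xᵈ⁺¹`: the morphisms `(α⁰, …, αᵈ⁻¹)` form a
`d`-kernel of `αᵈ`, i.e. `0 ⟶ Hom(Y, X⁰) ⟶ ⋯ ⟶ Hom(Y, Xᵈ) ⟶ Hom(Y, Xᵈ⁺¹)` is exact for all `Y`.
(For `d ≥ 1` such a sequence is a complex.) -/
def IsLeftDExact {d : ℕ} (S : ComposableArrows C (d + 1)) : Prop :=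
  ∀ Y : C, IsCoLeftExactOn (preadditiveCoyoneda.obj (op Y)) S

/-- `d`-exact sequences. -/
def IsDExact {d : ℕ} (S : ComposableArrows C (d + 1)) : Prop :=
  IsLeftDExact S ∧ IsRightDExact S

end Sequences

/-- `d`-abelian categories. -/
structure IsDAbelian (d : ℕ) (C : Type u) [Category.{v} C] [Preadditive C] : Prop where
  /-- Together with `Preadditive C`: the category is additive. -/
  hasFiniteBiproducts : HasFiniteBiproducts C
  isIdempotentComplete : IsIdempotentComplete C
  /-- Every morphism has a `d`-kernel. -/
  exists_dKernel : ∀ {A B : C} (f : A ⟶ B), ∃ S : ComposableArrows C (d + 1),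
    IsLeftDExact S ∧ Arrow.mk (S.map' d (d + 1)) = Arrow.mk f
  /-- Every morphism has a `d`-cokernel. -/
  exists_dCokernel : ∀ {A B : C} (f : A ⟶ B), ∃ S : ComposableArrows C (d + 1),
    IsRightDExact S ∧ Arrow.mk (S.map' 0 1) = Arrow.mk f
  /-- A monomorphism followed by any of its `d`-cokernels is a `d`-exact sequence. -/
  isDExact_of_mono : ∀ S : ComposableArrows C (d + 1),
    Mono (S.map' 0 1) → IsRightDExact S → IsDExact S
  /-- An epimorphism preceded by any of its `d`-kernels is a `d`-exact sequence. -/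
  isDExact_of_epi : ∀ S : ComposableArrows C (d + 1),
    Epi (S.map' d (d + 1)) → IsLeftDExact S → IsDExact S

section Modules

variable (C : Type u) [SmallCategory C] [Preadditive C]

/-- `Mod C`: additive contravariant functors from `C` to abelian groups. -/
abbrev Mod : Type (u + 1) := Cᵒᵖ ⥤+ AddCommGrpCat.{u}

/-- `Mod Cᵒᵖ`: additive covariant functors from `C` to abelian groups. -/
abbrev CoMod : Type (u + 1) := C ⥤+ AddCommGrpCat.{u}

/-- The Yoneda functor `C ⥤ Mod C`, `X ↦ Hom(-, X)`. -/
noncomputable def modYoneda : C ⥤ Mod C :=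
  ObjectProperty.lift _ preadditiveYoneda fun X =>
    inferInstanceAs (preadditiveYoneda.obj X).Additive

/-- `Ind C`, as a full subcategory of `Mod C`: the filtered colimits in `Mod C` of
representable functors. -/
def indCompletion : ObjectProperty (Mod C) :=
  ObjectProperty.ind.{u} (modYoneda C).essImage

/-- `L_d(C)`, the left `d`-exact functors in `Mod C`: those sending every right `d`-exact sequence
`X⁰ ⟶ ⋯ ⟶ Xᵈ⁺¹` of `C` (a left `d`-exact sequence of `Cᵒᵖ`) to an exact sequence
`0 ⟶ F(Xᵈ⁺¹) ⟶ ⋯ ⟶ F(X⁰)`. -/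
def leftDExactFunctors (d : ℕ) : ObjectProperty (Mod C) := fun F =>
  ∀ S : ComposableArrows C (d + 1), IsRightDExact S → IsLeftExactOn F.obj S

/-- The functors in `Mod C` sending every `d`-exact sequence `X⁰ ⟶ ⋯ ⟶ Xᵈ⁺¹` of `C` to an exact
sequence `0 ⟶ F(Xᵈ⁺¹) ⟶ ⋯ ⟶ F(X⁰)`. -/
def leftExactOnDExact (d : ℕ) : ObjectProperty (Mod C) := fun F =>
  ∀ S : ComposableArrows C (d + 1), IsDExact S → IsLeftExactOn F.obj S

end Modules

section Tensor

variable {C : Type u} [SmallCategory C] [Preadditive C]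

/-- The direct sum `⨁_X F(X) ⊗ G(X)`. -/
abbrev TensorSum (F : Mod C) (G : CoMod C) : Type u :=
  ⨁ X : C, (F.obj.obj (op X) ⊗[ℤ] G.obj.obj X)

open scoped Classical in
/-- The element `a ⊗ b` of the summand of `⨁_X F(X) ⊗ G(X)` at `X`. -/
noncomputable def TensorSum.tmul (F : Mod C) (G : CoMod C) (X : C)
    (a : F.obj.obj (op X)) (b : G.obj.obj X) : TensorSum F G :=
  DirectSum.of (fun X : C => (F.obj.obj (op X) ⊗[ℤ] G.obj.obj X)) X (a ⊗ₜ[ℤ] b)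

/-- The subgroup of relations `F(f)(a) ⊗ b - a ⊗ G(f)(b)`, for `f : X ⟶ Y`, `a ∈ F(Y)`,
`b ∈ G(X)`. -/
noncomputable def tensorRel (F : Mod C) (G : CoMod C) : AddSubgroup (TensorSum F G) :=
  AddSubgroup.closure { z | ∃ (X Y : C) (f : X ⟶ Y) (a : F.obj.obj (op Y)) (b : G.obj.obj X),
    z = TensorSum.tmul F G X (F.obj.map f.op a) b - TensorSum.tmul F G Y a (G.obj.map f b) }

/-- The tensor product `F ⊗_C G` (the coend of `F(X) ⊗ G(X)`). -/
abbrev Tensor (F : Mod C) (G : CoMod C) : Type u := TensorSum F G ⧸ tensorRel F G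

/-- The map `⨁_X F(X) ⊗ G(X) ⟶ ⨁_X F(X) ⊗ G'(X)` induced by `g : G ⟶ G'`. -/
noncomputable def tensorSumMap (F : Mod C) {G G' : CoMod C} (g : G ⟶ G') :
    TensorSum F G →+ TensorSum F G' :=
  DirectSum.map fun X : C =>
    (LinearMap.lTensor (F.obj.obj (op X)) (g.hom.app X).hom.toIntLinearMap).toAddMonoidHom

lemma tensorSumMap_tmul (F : Mod C) {G G' : CoMod C} (g : G ⟶ G') (X : C)
    (a : F.obj.obj (op X)) (b : G.obj.obj X) :
    tensorSumMap F g (TensorSum.tmul F G X a b) = TensorSum.tmul F G' X a (g.hom.app X b) := by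
  classical
  unfold tensorSumMap TensorSum.tmul
  convert DirectSum.map_of _ X _ using 1
  rfl

lemma tensorRel_le_comap (F : Mod C) {G G' : CoMod C} (g : G ⟶ G') :
    tensorRel F G ≤ (tensorRel F G').comap (tensorSumMap F g) := by
  refine (AddSubgroup.closure_le _).2 ?_
  rintro _ ⟨X, Y, f, a, b, rfl⟩
  refine AddSubgroup.subset_closure ⟨X, Y, f, a, g.hom.app X b, ?_⟩
  have h : g.hom.app Y (G.obj.map f b) = G'.obj.map f (g.hom.app X b) :=
    ConcreteCategory.congr_hom (g.hom.naturality f) b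
  rw [map_sub, tensorSumMap_tmul, tensorSumMap_tmul, h]

/-- The map `F ⊗_C G ⟶ F ⊗_C G'` induced by `g : G ⟶ G'`. -/
noncomputable def tensorMap (F : Mod C) {G G' : CoMod C} (g : G ⟶ G') :
    Tensor F G →+ Tensor F G' :=
  QuotientAddGroup.map _ _ (tensorSumMap F g) (tensorRel_le_comap F g)

variable (C) in
/-- `Flat C`: the functors `F` in `Mod C` such that `F ⊗_C -` is exact, i.e. sends every (pointwise)
exact sequence `G₁ ⟶ G₂ ⟶ G₃` in `Mod Cᵒᵖ` to an exact sequence of abelian groups. -/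
def flatFunctors : ObjectProperty (Mod C) := fun F =>
  ∀ {G₁ G₂ G₃ : CoMod C} (g : G₁ ⟶ G₂) (h : G₂ ⟶ G₃),
    (∀ X : C, Function.Exact (g.hom.app X) (h.hom.app X)) →
      Function.Exact (tensorMap F g) (tensorMap F h)

end Tensor

end DAbelian

/-!
The three classes of functors are compared with the functors `F` satisfying the equational criterion
for flatness `IsEquationallyFlat`: if `a ∈ F(Y)` vanishes on `X` under `f : X ⟶ Y`, then `a` is the
restriction of an element of `F(Z)` along some `g : Y ⟶ Z` with `f ≫ g = 0`.

For an additive `F` the criterion says that the category of elements of `F` is filtered. As every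
functor is the colimit of the representable functors over it (`isColimitElementCocone`), such an
`F` lies in `Ind`; moreover `F ⊗ G` is then a filtered colimit of the groups `G(X)`, so that `F` is
flat (`IsEquationallyFlat.exists_of_tensorMk_eq_zero`). Conversely, filtered colimits of
representable functors satisfy the criterion since colimits are computed objectwise, and flat
functors satisfy it by exactness of `F ⊗ -` on `{g | f ≫ g = 0} ⟶ Hom(Y, -) ⟶ Hom(X, -)`.

The criterion for `f` follows from exactness of `F` at the second place of the right `d`-exact
sequence given by a `d`-cokernel of `f`. Conversely, the element `g` in the criterion is a morphism
to a representable functor, and this reduces exactness of `F` on right `d`-exact sequences to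
exactness of the functors `Hom(-, Z)` (`IsEquationallyFlat.isLeftExactOn`).

It remains to see that a functor `F` which is exact on `d`-exact sequences is exact at the second
place of a right `d`-exact sequence `X` (`resExact_of_weakCokernelUpToMono`). The last morphism of
`X` is an epimorphism, so it is also the last morphism of a `d`-exact sequence `K`. There is a chain
map `X ⟶ K` which is the identity in the last two degrees. Its mapping cone, with the contractible
part coming from these degrees removed, is shorter than `X`. As `F` is exact on `K`, exactness of
`F` at the second place of the cone implies exactness at the second place of `X`, so one can
continue with the cone in place of `X`. The cone is in general not right `d`-exact, because `K` is not exact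
for contravariant `Hom` at its left end. However, monomorphisms are stable under weak pushouts,
so that each morphism out of the left end of `K` extends to the next term after composition with a
monomorphism. Exactness up to monomorphisms in this sense, `WeakCokernelUpToMono`, passes to the
cone and still implies that the last morphism is an epimorphism. The process ends with a complex
`C₁ ⟶ C₀` consisting of an epimorphism, on which `F` is injective.
-/

namespace DAbelian

/-! ### Restriction of elements, exactness up to monomorphisms and mapping cones -/

/-- The restriction map `F(Y) → F(X)` along `f : X ⟶ Y` of a contravariant functor `F`. -/
def res {C : Type u} [Category.{v} C] (F : Cᵒᵖ ⥤ AddCommGrpCat.{w}) {X Y : C} (f : X ⟶ Y) :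
    F.obj (op Y) →+ F.obj (op X) :=
  (F.map f.op).hom

section Res

variable {C : Type u} [Category.{v} C]
variable (F : Cᵒᵖ ⥤ AddCommGrpCat.{w}) {X Y Z : C}

lemma res_comp (f : X ⟶ Y) (g : Y ⟶ Z) (a : F.obj (op Z)) :
    res F (f ≫ g) a = res F f (res F g a) := by
  simp [res]

@[simp]
lemma res_id (a : F.obj (op X)) : res F (𝟙 X) a = a := by
  simp [res]

variable [Preadditive C] [F.Additive]

@[simp]
lemma res_zero (a : F.obj (op Y)) : res F (0 : X ⟶ Y) a = 0 := by
  simp [res]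

lemma res_add (f g : X ⟶ Y) (a : F.obj (op Y)) : res F (f + g) a = res F f a + res F g a := by
  simp [res, Functor.map_add]

lemma res_neg (f : X ⟶ Y) (a : F.obj (op Y)) : res F (-f) a = -res F f a := by
  simp [res, Functor.map_neg]

lemma res_sub (f g : X ⟶ Y) (a : F.obj (op Y)) : res F (f - g) a = res F f a - res F g a := by
  simp [res, Functor.map_sub]

end Res

section Exactness

variable {C : Type u} [Category.{v} C] [Preadditive C]

variable {X Y Z : C}

/-- `f` is a weak kernel of `g`, up to the condition `f ≫ g = 0`. -/
def WeakKernel (f : X ⟶ Y) (g : Y ⟶ Z) : Prop :=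
  ∀ ⦃T : C⦄ (t : T ⟶ Y), t ≫ g = 0 → ∃ s : T ⟶ X, s ≫ f = t

/-- Up to enlarging the target along a monomorphism, a morphism out of `Y` which vanishes on `X`
extends to `Z`. -/
def WeakCokernelUpToMono (f : X ⟶ Y) (g : Y ⟶ Z) : Prop :=
  ∀ ⦃W : C⦄ (p : Y ⟶ W), f ≫ p = 0 →
    ∃ (W' : C) (m : W ⟶ W') (h : Z ⟶ W'), Mono m ∧ g ≫ h = p ≫ m

/-- Every element of `F(Y)` which vanishes on `X` comes from `F(Z)`. -/
def ResExact (F : Cᵒᵖ ⥤ AddCommGrpCat.{w}) (f : X ⟶ Y) (g : Y ⟶ Z) : Prop :=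
  ∀ a : F.obj (op Y), res F f a = 0 → ∃ b : F.obj (op Z), res F g b = a

/-- A resolution of the morphism `f : A ⟶ B` from the left, by a sequence
`⋯ ⟶ K₁ ⟶ K₀ ⟶ A ⟶ B` which is exact for covariant `Hom`, and for contravariant `Hom` up to
enlarging the target along a monomorphism. -/
structure LeftResolution {A B : C} (f : A ⟶ B) where
  /-- The objects of the resolution. -/
  K : ℕ → C
  /-- The differentials of the resolution. -/
  D (j : ℕ) : K (j + 1) ⟶ K j
  /-- The augmentation. -/
  κ : K 0 ⟶ A
  κ_comp : κ ≫ f = 0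
  D_comp_κ : D 0 ≫ κ = 0
  D_comp_D (j : ℕ) : D (j + 1) ≫ D j = 0
  weakKernel_κ : WeakKernel κ f
  weakKernel_zero : WeakKernel (D 0) κ
  weakKernel_succ (j : ℕ) : WeakKernel (D (j + 1)) (D j)
  weakCokernel_zero : WeakCokernelUpToMono (D 0) κ
  weakCokernel_succ (j : ℕ) : WeakCokernelUpToMono (D (j + 1)) (D j)

namespace LeftResolution

/-- The exactness conditions which a functor exact on all `d`-exact sequences satisfies on the
resolution of an epimorphism by one of its `d`-kernels. -/
structure IsExactOn {A B : C} {f : A ⟶ B} (R : LeftResolution f)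
    (F : Cᵒᵖ ⥤ AddCommGrpCat.{w}) (d : ℕ) : Prop where
  κ : ResExact F R.κ f
  zero : 1 < d → ResExact F (R.D 0) R.κ
  succ (j : ℕ) (hj : j + 2 < d) : ResExact F (R.D (j + 1)) (R.D j)

section Cone

variable {X : ℕ → C} {δ : ∀ j, X (j + 1) ⟶ X j} (R : LeftResolution (δ 0))

lemma exists_lift (hδ : ∀ j, δ (j + 1) ≫ δ j = 0) :
    ∃ u : ∀ j, X (j + 2) ⟶ R.K j,
      u 0 ≫ R.κ = δ 1 ∧ ∀ j, u (j + 1) ≫ R.D j = δ (j + 2) ≫ u j := by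
  obtain ⟨u₀, hu₀⟩ := R.weakKernel_κ (δ 1) (hδ 0)
  -- The recursion carries along that the next lift exists.
  let v : ∀ j, { s : X (j + 2) ⟶ R.K j // ∃ s', s' ≫ R.D j = δ (j + 2) ≫ s } := fun j =>
    Nat.rec ⟨u₀, R.weakKernel_zero _ (by rw [Category.assoc, hu₀, hδ])⟩
      (fun j s => ⟨s.2.choose, R.weakKernel_succ j _ (by
        rw [Category.assoc, s.2.choose_spec, ← Category.assoc, hδ, zero_comp])⟩) j
  exact ⟨fun j => (v j).1, hu₀, fun j => (v j).2.choose_spec⟩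

variable [HasBinaryBiproducts C]

/-- The objects of the mapping cone of a chain map from `X` to a resolution of `X₁ ⟶ X₀`, after
removing the contractible part given by `X₁` and `X₀`. -/
noncomputable def coneObj (X : ℕ → C) (K : ℕ → C) : ℕ → C
  | 0 => K 0
  | j + 1 => X (j + 2) ⊞ K (j + 1)

/-- The differentials of the mapping cone, after removing the contractible part given by `X₁` and
`X₀`. -/
noncomputable def coneMap (u : ∀ j, X (j + 2) ⟶ R.K j) :
    ∀ j, coneObj X R.K (j + 1) ⟶ coneObj X R.K j
  | 0 => (biprod.desc (u 0) (R.D 0) : X 2 ⊞ R.K 1 ⟶ R.K 0)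
  | j + 1 => (biprod.desc (biprod.lift (-δ (j + 2)) (u (j + 1))) (biprod.lift 0 (R.D (j + 1))) :
      X (j + 3) ⊞ R.K (j + 2) ⟶ X (j + 2) ⊞ R.K (j + 1))

variable {R} {u : ∀ j, X (j + 2) ⟶ R.K j}

lemma coneMap_comp (hδ : ∀ j, δ (j + 1) ≫ δ j = 0)
    (hu : ∀ j, u (j + 1) ≫ R.D j = δ (j + 2) ≫ u j) (j : ℕ) :
    R.coneMap u (j + 1) ≫ R.coneMap u j = 0 := by
  cases j with
  | zero =>
    change biprod.desc (biprod.lift (-δ 2) (u 1)) (biprod.lift 0 (R.D 1)) ≫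
      biprod.desc (u 0) (R.D 0) = 0
    ext <;> simp [hu, R.D_comp_D]
  | succ j =>
    change biprod.desc (biprod.lift (-δ (j + 3)) (u (j + 2))) (biprod.lift 0 (R.D (j + 2))) ≫
      biprod.desc (biprod.lift (-δ (j + 2)) (u (j + 1))) (biprod.lift 0 (R.D (j + 1))) = 0
    ext <;> simp [hu, hδ, R.D_comp_D]

lemma epi_coneMap (hu₀ : u 0 ≫ R.κ = δ 1) [Epi (δ 0)]
    (h₀ : WeakCokernelUpToMono (δ 1) (δ 0)) : Epi (R.coneMap u 0) := by
  refine Preadditive.epi_of_cancel_zero (biprod.desc (u 0) (R.D 0)) fun {W} (g : R.K 0 ⟶ W) hg => ?_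
  have h₁ : u 0 ≫ g = 0 := by simpa using biprod.inl ≫= hg
  have h₂ : R.D 0 ≫ g = 0 := by simpa using biprod.inr ≫= hg
  obtain ⟨W', m, h, hm, e⟩ := R.weakCokernel_zero g h₂
  obtain ⟨W'', m', h', hm', e'⟩ := h₀ h (by
    rw [← hu₀, Category.assoc, e, reassoc_of% h₁, zero_comp])
  rw [← cancel_mono m, ← cancel_mono m', ← e, Category.assoc, ← e', ← Category.assoc,
    R.κ_comp, zero_comp, zero_comp, zero_comp]

lemma weakCokernel_coneMap_zero (hu₀ : u 0 ≫ R.κ = δ 1)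
    (hu : ∀ j, u (j + 1) ≫ R.D j = δ (j + 2) ≫ u j)
    (h₁ : WeakCokernelUpToMono (δ 2) (δ 1)) :
    WeakCokernelUpToMono (R.coneMap u 1) (R.coneMap u 0) := by
  intro W (p : X 2 ⊞ R.K 1 ⟶ W) hp
  change biprod.desc (biprod.lift (-δ 2) (u 1)) (biprod.lift 0 (R.D 1)) ≫ p = 0 at hp
  obtain ⟨p₁, p₂, rfl⟩ : ∃ p₁ p₂, p = biprod.desc p₁ p₂ :=
    ⟨biprod.inl ≫ p, biprod.inr ≫ p, by ext <;> simp⟩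
  have e₁ : u 1 ≫ p₂ = δ 2 ≫ p₁ := by
    exact (neg_add_eq_zero.1 (by simpa using biprod.inl ≫= hp)).symm
  have e₂ : R.D 1 ≫ p₂ = 0 := by simpa using biprod.inr ≫= hp
  obtain ⟨W', m, q, hm, hq⟩ := R.weakCokernel_succ 0 p₂ e₂
  obtain ⟨W'', m', r, hm', hr⟩ := h₁ (p₁ ≫ m - u 0 ≫ q) (by
    rw [Preadditive.comp_sub, ← Category.assoc, ← e₁, ← Category.assoc (δ 2), ← hu,
      Category.assoc, Category.assoc, hq, sub_self])
  refine ⟨W'', m ≫ m', R.κ ≫ r + q ≫ m', inferInstance, ?_⟩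
  change biprod.desc (u 0) (R.D 0) ≫ _ = biprod.desc p₁ p₂ ≫ m ≫ m'
  ext
  · simp [reassoc_of% hu₀, hr, Preadditive.sub_comp]
  · simp [reassoc_of% R.D_comp_κ, reassoc_of% hq]

lemma weakCokernel_coneMap_succ
    (hu : ∀ j, u (j + 1) ≫ R.D j = δ (j + 2) ≫ u j) (j : ℕ)
    (h₁ : WeakCokernelUpToMono (δ (j + 3)) (δ (j + 2))) :
    WeakCokernelUpToMono (R.coneMap u (j + 2)) (R.coneMap u (j + 1)) := by
  intro W (p : X (j + 3) ⊞ R.K (j + 2) ⟶ W) hp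
  change biprod.desc (biprod.lift (-δ (j + 3)) (u (j + 2))) (biprod.lift 0 (R.D (j + 2))) ≫ p = 0
    at hp
  obtain ⟨p₁, p₂, rfl⟩ : ∃ p₁ p₂, p = biprod.desc p₁ p₂ :=
    ⟨biprod.inl ≫ p, biprod.inr ≫ p, by ext <;> simp⟩
  have e₁ : u (j + 2) ≫ p₂ = δ (j + 3) ≫ p₁ := by
    exact (neg_add_eq_zero.1 (by simpa using biprod.inl ≫= hp)).symm
  have e₂ : R.D (j + 2) ≫ p₂ = 0 := by simpa using biprod.inr ≫= hp
  obtain ⟨W', m, q, hm, hq⟩ := R.weakCokernel_succ (j + 1) p₂ e₂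
  obtain ⟨W'', m', r, hm', hr⟩ := h₁ (p₁ ≫ m - u (j + 1) ≫ q) (by
    rw [Preadditive.comp_sub, ← Category.assoc, ← e₁, ← Category.assoc (δ (j + 3)), ← hu,
      Category.assoc, Category.assoc, hq, sub_self])
  refine ⟨W'', m ≫ m', biprod.desc (-r) (q ≫ m'), inferInstance, ?_⟩
  change biprod.desc (biprod.lift (-δ (j + 2)) (u (j + 1))) (biprod.lift 0 (R.D (j + 1))) ≫ _ =
    biprod.desc p₁ p₂ ≫ m ≫ m'
  ext
  · simp [hr, Preadditive.sub_comp]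
  · simp [reassoc_of% hq]

variable {F : Cᵒᵖ ⥤ AddCommGrpCat.{w}} {d : ℕ}

lemma resExact_of_injective (hR : R.IsExactOn F d) (hu₀ : u 0 ≫ R.κ = δ 1)
    (hF : Function.Injective (res F (R.coneMap u 0))) : ResExact F (δ 1) (δ 0) := by
  intro a ha
  refine hR.κ a (hF (Eq.trans ?_ (map_zero _).symm))
  change res F (biprod.desc (u 0) (R.D 0)) (res F R.κ a) = 0
  have : biprod.desc (u 0) (R.D 0) ≫ R.κ = biprod.fst ≫ δ 1 := by
    ext <;> simp [hu₀, R.D_comp_κ]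
  rw [← res_comp, this, res_comp, ha, map_zero]

variable [F.Additive]

lemma resExact_of_coneMap_zero (hR : R.IsExactOn F d) (hd : 1 < d) (hu₀ : u 0 ≫ R.κ = δ 1)
    (h : ResExact F (R.coneMap u 1) (R.coneMap u 0)) : ResExact F (δ 2) (δ 1) := by
  intro a ha
  obtain ⟨(b : F.obj (op (R.K 0))), hb⟩ := h (res F (biprod.fst : X 2 ⊞ R.K 1 ⟶ X 2) a) (by
    change res F (biprod.desc (biprod.lift (-δ 2) (u 1)) (biprod.lift 0 (R.D 1))) _ = 0
    have : biprod.desc (biprod.lift (-δ 2) (u 1)) (biprod.lift 0 (R.D 1)) ≫ biprod.fst =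
        -(biprod.fst ≫ δ 2) := by ext <;> simp
    rw [← res_comp, this, res_neg, res_comp, ha, map_zero, neg_zero])
  change res F (biprod.desc (u 0) (R.D 0)) b =
    res F (biprod.fst : X 2 ⊞ R.K 1 ⟶ X 2) a at hb
  have hb₁ : res F (u 0) b = a := by
    simpa [← res_comp] using congrArg (res F biprod.inl) hb
  have hb₂ : res F (R.D 0) b = 0 := by
    simpa [← res_comp] using congrArg (res F biprod.inr) hb
  obtain ⟨c, rfl⟩ := hR.zero hd b hb₂
  exact ⟨c, by rw [← hu₀, res_comp, hb₁]⟩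

lemma resExact_of_coneMap_succ (hR : R.IsExactOn F d) (j : ℕ) (hd : j + 2 < d)
    (hu : ∀ j, u (j + 1) ≫ R.D j = δ (j + 2) ≫ u j)
    (h : ResExact F (R.coneMap u (j + 2)) (R.coneMap u (j + 1))) :
    ResExact F (δ (j + 3)) (δ (j + 2)) := by
  intro a ha
  obtain ⟨(b : F.obj (op (X (j + 2) ⊞ R.K (j + 1)))), hb⟩ :=
      h (res F (biprod.fst : X (j + 3) ⊞ R.K (j + 2) ⟶ X (j + 3)) a) (by
    change res F (biprod.desc (biprod.lift (-δ (j + 3)) (u (j + 2)))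
      (biprod.lift 0 (R.D (j + 2)))) _ = 0
    have : biprod.desc (biprod.lift (-δ (j + 3)) (u (j + 2))) (biprod.lift 0 (R.D (j + 2))) ≫
        biprod.fst = -(biprod.fst ≫ δ (j + 3)) := by ext <;> simp
    rw [← res_comp, this, res_neg, res_comp, ha, map_zero, neg_zero])
  change res F (biprod.desc (biprod.lift (-δ (j + 2)) (u (j + 1))) (biprod.lift 0 (R.D (j + 1))))
    b =
    res F (biprod.fst : X (j + 3) ⊞ R.K (j + 2) ⟶ X (j + 3)) a at hb
  have hb₁ : res F (biprod.lift (-δ (j + 2)) (u (j + 1))) b = a := by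
    simpa [← res_comp] using congrArg (res F biprod.inl) hb
  have hb₂ : res F (R.D (j + 1)) (res F biprod.inr b) = 0 := by
    have : biprod.lift (0 : R.K (j + 2) ⟶ X (j + 2)) (R.D (j + 1)) = R.D (j + 1) ≫ biprod.inr := by
      ext <;> simp
    simpa [← res_comp, this] using congrArg (res F biprod.inr) hb
  obtain ⟨c, hc⟩ := hR.succ j hd _ hb₂
  refine ⟨-res F biprod.inl b + res F (u j) c, ?_⟩
  have : biprod.lift (-δ (j + 2)) (u (j + 1)) =
      -(δ (j + 2) ≫ biprod.inl) + u (j + 1) ≫ biprod.inr := by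
    ext <;> simp
  rw [map_add, map_neg, ← res_comp, ← res_comp, ← hu, res_comp F (u (j + 1)), hc, ← hb₁, this,
    res_add, res_neg, res_comp F (u (j + 1))]

end Cone

end LeftResolution

/-- If `F` is exact on suitable resolutions of all epimorphisms, then it is exact at `X_{k+1}` for a
complex `X_{k+2} ⟶ ⋯ ⟶ X₁ ⟶ X₀` which ends with an epimorphism and is exact for contravariant `Hom`
up to monomorphisms. The induction replaces `X` by the mapping cone of a lift of `X` to a resolution
of the epimorphism `X₁ ⟶ X₀`, which is shorter. The bound `k < d` ensures that exactness of `F` is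
only used at the places of the resolution where it holds. -/
lemma resExact_of_weakCokernelUpToMono [HasBinaryBiproducts C] {F : Cᵒᵖ ⥤ AddCommGrpCat.{w}}
    [F.Additive] {d : ℕ}
    (hF : ∀ ⦃A B : C⦄ (f : A ⟶ B), Epi f → Function.Injective (res F f))
    (hR : ∀ ⦃A B : C⦄ (f : A ⟶ B), Epi f → ∃ R : LeftResolution f, R.IsExactOn F d)
    (k : ℕ) (hk : k < d) {X : ℕ → C} {δ : ∀ j, X (j + 1) ⟶ X j}
    (hδ : ∀ j, δ (j + 1) ≫ δ j = 0) (hδ₀ : Epi (δ 0))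
    (h : ∀ j ≤ k, WeakCokernelUpToMono (δ (j + 1)) (δ j)) :
    ResExact F (δ (k + 1)) (δ k) := by
  induction k generalizing X with
  | zero =>
    obtain ⟨R, hR⟩ := hR (δ 0) hδ₀
    obtain ⟨u, hu₀, hu⟩ := R.exists_lift hδ
    exact LeftResolution.resExact_of_injective hR hu₀
      (hF _ (LeftResolution.epi_coneMap hu₀ (h 0 le_rfl)))
  | succ k ih =>
    obtain ⟨R, hR⟩ := hR (δ 0) hδ₀
    obtain ⟨u, hu₀, hu⟩ := R.exists_lift hδ
    have key : ResExact F (R.coneMap u (k + 1)) (R.coneMap u k) := by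
      refine ih (by lia) (LeftResolution.coneMap_comp hδ hu)
        (LeftResolution.epi_coneMap hu₀ (h 0 (by lia))) fun j hj => ?_
      cases j with
      | zero => exact LeftResolution.weakCokernel_coneMap_zero hu₀ hu (h 1 (by lia))
      | succ j => exact LeftResolution.weakCokernel_coneMap_succ hu j (h (j + 2) (by lia))
    cases k with
    | zero => exact LeftResolution.resExact_of_coneMap_zero hR hk hu₀ key
    | succ k => exact LeftResolution.resExact_of_coneMap_succ hR k hk hu key

end Exactness

/-! ### Right `d`-exact sequences and resolutions in `d`-abelian categories -/

section

variable {C : Type u} [Category.{v} C] {d : ℕ}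

lemma IsLeftExactOn.resExact {F : Cᵒᵖ ⥤ AddCommGrpCat.{w}} {S : ComposableArrows C (d + 1)}
    (h : IsLeftExactOn F S) {a b c : ℕ} (hab : a + 1 = b) (hbc : b + 1 = c) (hc : c ≤ d + 1) :
    ResExact F (S.map' a b) (S.map' b c) := by
  subst hab hbc
  exact fun x hx => (h.2 a (by lia) x).1 hx

end

section Reverse

variable {C : Type u} [Category.{v} C] [Preadditive C] {d : ℕ}

lemma IsRightDExact.exists_extension {S : ComposableArrows C (d + 1)} (h : IsRightDExact S)
    {a b c : ℕ} (hab : a + 1 = b) (hbc : b + 1 = c) (hc : c ≤ d + 1) {W : C}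
    (p : S.obj' b ⟶ W) (hp : S.map' a b ≫ p = 0) : ∃ q : S.obj' c ⟶ W, S.map' b c ≫ q = p :=
  (h W).resExact hab hbc hc p hp

lemma IsRightDExact.map_comp {S : ComposableArrows C (d + 1)} (h : IsRightDExact S)
    {a b c : ℕ} (hab : a + 1 = b) (hbc : b + 1 = c) (hc : c ≤ d + 1) :
    S.map' a b ≫ S.map' b c = 0 := by
  subst hab hbc
  exact ((h (S.obj' (a + 2))).2 a (by lia) _).2 ⟨𝟙 (S.obj' (a + 2)), Category.comp_id _⟩

lemma IsRightDExact.epi {S : ComposableArrows C (d + 1)} (h : IsRightDExact S) :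
    Epi (S.map' d (d + 1)) :=
  Preadditive.epi_of_cancel_zero _ fun {W} _ hg => (h W).1 (hg.trans comp_zero.symm)

lemma IsLeftDExact.weakKernel {S : ComposableArrows C (d + 1)} (h : IsLeftDExact S)
    {a b c : ℕ} (hab : a + 1 = b) (hbc : b + 1 = c) (hc : c ≤ d + 1) :
    WeakKernel (S.map' a b) (S.map' b c) := by
  subst hab hbc
  exact fun T t ht => ((h T).2 a (by lia) t).1 ht

lemma IsLeftDExact.mono {S : ComposableArrows C (d + 1)} (h : IsLeftDExact S) :
    Mono (S.map' 0 1) :=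
  Preadditive.mono_of_cancel_zero _ fun {T} _ hg => (h T).1 (hg.trans zero_comp.symm)

/-- The objects of `X⁰ ⟶ ⋯ ⟶ Xᵈ⁺¹` numbered from the right, continued to the left by copies
of `X⁰`. -/
abbrev revObj (S : ComposableArrows C (d + 1)) (j : ℕ) : C := S.obj' (d + 1 - j)

/-- The morphisms of `X⁰ ⟶ ⋯ ⟶ Xᵈ⁺¹` numbered from the right. To the left of `X⁰` they are
alternately zero and the identity of `X⁰`, so that the sequence is exact at all places to the left
of `X⁰`. -/
noncomputable def revMap (S : ComposableArrows C (d + 1)) (j : ℕ) :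
    revObj S (j + 1) ⟶ revObj S j :=
  if j ≤ d ∨ ¬ Even (j - (d + 1)) then S.map' (d + 1 - (j + 1)) (d + 1 - j) else 0

variable (S : ComposableArrows C (d + 1)) {j : ℕ}

lemma revMap_of_le (hj : j ≤ d) : revMap S j = S.map' (d + 1 - (j + 1)) (d + 1 - j) :=
  if_pos (Or.inl hj)

lemma revMap_self_add_one : revMap S (d + 1) = 0 :=
  if_neg (by simp)

lemma isIso_revMap (hj : d < j) (h : ¬ Even (j - (d + 1))) : IsIso (revMap S j) := by
  have (a b : ℕ) (hab : a = b) (hb : b ≤ d + 1) : IsIso (S.map' a b) := by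
    subst hab
    rw [ComposableArrows.map'_self S a hb]
    infer_instance
  rw [revMap, if_pos (Or.inr h)]
  exact this _ _ (by lia) (by lia)

/-- To the left of `X⁰`, of two successive morphisms one is zero and the other is invertible. -/
lemma revMap_cases (hj : d < j) :
    (revMap S j = 0 ∧ IsIso (revMap S (j + 1))) ∨ (IsIso (revMap S j) ∧ revMap S (j + 1) = 0) := by
  have e : j + 1 - (d + 1) = (j - (d + 1)) + 1 := by lia
  by_cases h : Even (j - (d + 1))
  · refine Or.inl ⟨if_neg (not_or.2 ⟨by lia, not_not.2 h⟩), isIso_revMap S (by lia) ?_⟩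
    rw [e, Nat.even_add_one]
    exact not_not.2 h
  · refine Or.inr ⟨isIso_revMap S hj h, if_neg (not_or.2 ⟨by lia, not_not.2 ?_⟩)⟩
    rwa [e, Nat.even_add_one]

variable {S}

lemma IsRightDExact.revMap_comp (h : IsRightDExact S) (j : ℕ) :
    revMap S (j + 1) ≫ revMap S j = 0 := by
  rcases lt_trichotomy j d with hj | rfl | hj
  · rw [revMap_of_le S (by lia : j + 1 ≤ d), revMap_of_le S (by lia : j ≤ d)]
    exact h.map_comp (by lia) (by lia) (by lia)
  · rw [revMap_self_add_one, zero_comp]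
  · rcases revMap_cases S hj with ⟨h, -⟩ | ⟨-, h⟩
    · rw [h, comp_zero]
    · rw [h, zero_comp]

lemma IsRightDExact.epi_revMap (h : IsRightDExact S) : Epi (revMap S 0) := by
  rw [revMap_of_le S (by lia)]
  exact h.epi

lemma mono_revMap (h : Mono (S.map' 0 1)) : Mono (revMap S d) := by
  have (a b : ℕ) (ha : a = 0) (hb : b = 1) : Mono (S.map' a b) := by
    subst ha hb
    exact h
  rw [revMap_of_le S le_rfl]
  exact this _ _ (by lia) (by lia)

lemma IsRightDExact.weakCokernelUpToMono_revMap (h : IsRightDExact S) (hj : j < d) :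
    WeakCokernelUpToMono (revMap S (j + 1)) (revMap S j) := by
  intro W p hp
  rw [revMap_of_le S (by lia : j + 1 ≤ d)] at hp
  rw [revMap_of_le S (by lia : j ≤ d)]
  obtain ⟨q, hq⟩ := h.exists_extension (c := d + 1 - j) (by lia) (by lia) (by lia) p hp
  exact ⟨W, 𝟙 W, q, inferInstance, by rw [hq, Category.comp_id]⟩

lemma IsLeftDExact.weakKernel_revMap (h : IsLeftDExact S) (j : ℕ) :
    WeakKernel (revMap S (j + 1)) (revMap S j) := by
  rcases lt_trichotomy j d with hj | rfl | hj
  · rw [revMap_of_le S (by lia : j + 1 ≤ d), revMap_of_le S (by lia : j ≤ d)]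
    exact h.weakKernel (by lia) (by lia) (by lia)
  · intro T t ht
    have := mono_revMap h.mono
    exact ⟨0, by rw [zero_comp, (cancel_mono (revMap S j)).1 (ht.trans zero_comp.symm)]⟩
  · rcases revMap_cases S hj with ⟨-, h⟩ | ⟨h, -⟩
    · exact fun T t _ => ⟨t ≫ inv (revMap S (j + 1)), by simp⟩
    · exact fun T t ht => ⟨0, by
        rw [zero_comp, (cancel_mono (revMap S j)).1 (ht.trans zero_comp.symm)]⟩

lemma IsLeftExactOn.resExact_revMap {F : Cᵒᵖ ⥤ AddCommGrpCat.{w}} (h : IsLeftExactOn F S)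
    (hj : j < d) : ResExact F (revMap S (j + 1)) (revMap S j) := by
  rw [revMap_of_le S (by lia : j + 1 ≤ d), revMap_of_le S (by lia : j ≤ d)]
  exact h.resExact (by lia) (by lia) (by lia)

namespace IsDAbelian

variable (hM : IsDAbelian d C)

include hM

/-- A property of morphisms holds for `f` if it holds for the first morphism of each right
`d`-exact sequence. -/
lemma of_forall_isRightDExact {A B : C} (f : A ⟶ B) (P : ∀ {A B : C}, (A ⟶ B) → Prop)
    (h : ∀ S : ComposableArrows C (d + 1), IsRightDExact S → P (S.map' 0 1)) : P f := by
  obtain ⟨S, hS, e⟩ := hM.exists_dCokernel f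
  have (a : Arrow C) (ha : Arrow.mk (S.map' 0 1) = a) : P a.hom := by
    subst ha
    exact h S hS
  exact this _ e

/-- A property of morphisms holds for an epimorphism `f` if it holds for the last morphism of each
`d`-exact sequence. -/
lemma of_forall_isDExact_of_epi {A B : C} (f : A ⟶ B) [Epi f] (P : ∀ {A B : C}, (A ⟶ B) → Prop)
    (h : ∀ S : ComposableArrows C (d + 1), IsDExact S → P (S.map' d (d + 1))) : P f := by
  obtain ⟨S, hS, e⟩ := hM.exists_dKernel f
  have (a : Arrow C) (ha : Arrow.mk (S.map' d (d + 1)) = a) (hepi : Epi a.hom) : P a.hom := by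
    subst ha
    exact h S (hM.isDExact_of_epi S hepi hS)
  exact this _ e ‹Epi f›

/-- A property of morphisms holds for a monomorphism `f` if it holds for the first morphism of each
`d`-exact sequence. -/
lemma of_forall_isDExact_of_mono {A B : C} (f : A ⟶ B) [Mono f]
    (P : ∀ {A B : C}, (A ⟶ B) → Prop)
    (h : ∀ S : ComposableArrows C (d + 1), IsDExact S → P (S.map' 0 1)) : P f := by
  obtain ⟨S, hS, e⟩ := hM.exists_dCokernel f
  have (a : Arrow C) (ha : Arrow.mk (S.map' 0 1) = a) (hmono : Mono a.hom) : P a.hom := by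
    subst ha
    exact h S (hM.isDExact_of_mono S hmono hS)
  exact this _ e ‹Mono f›

/-- Monomorphisms are stable under weak pushouts. -/
lemma exists_mono_of_mono (hd : 1 ≤ d) {A B W : C} (f : A ⟶ B) [Mono f] (p : A ⟶ W) :
    ∃ (W' : C) (m : W ⟶ W') (h : B ⟶ W'), Mono m ∧ f ≫ h = p ≫ m := by
  have := hM.hasFiniteBiproducts
  have := hasBinaryBiproducts_of_finite_biproducts C
  -- A `d`-cokernel of the monomorphism `(f, -p)` is also a weak pushout of `f` and `p`.
  obtain ⟨Z, g, hg₀, hg⟩ : ∃ (Z : C) (g : B ⊞ W ⟶ Z),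
      biprod.lift f (-p) ≫ g = 0 ∧ WeakKernel (biprod.lift f (-p)) g := by
    have : Mono (biprod.lift f (-p)) :=
      have : Mono (biprod.lift f (-p) ≫ biprod.fst) := by rw [biprod.lift_fst]; infer_instance
      mono_of_mono _ biprod.fst
    exact hM.of_forall_isDExact_of_mono (biprod.lift f (-p))
      (fun {X Y} k => ∃ (Z : C) (g : Y ⟶ Z), k ≫ g = 0 ∧ WeakKernel k g)
      fun S hS => ⟨S.obj' 2, S.map' 1 2, hS.2.map_comp rfl rfl (by lia),
        hS.1.weakKernel rfl rfl (by lia)⟩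
  refine ⟨Z, biprod.inr ≫ g, biprod.inl ≫ g,
    Preadditive.mono_of_cancel_zero _ fun {T} t ht => ?_, ?_⟩
  · obtain ⟨s, hs⟩ := hg (t ≫ biprod.inr) (by simpa using ht)
    have h₁ : s ≫ f = 0 := by simpa using hs =≫ biprod.fst
    have h₂ : -(s ≫ p) = t := by simpa using hs =≫ biprod.snd
    rw [← h₂, (cancel_mono f).1 (h₁.trans zero_comp.symm), zero_comp, neg_zero]
  · rw [← sub_eq_zero, ← hg₀, biprod.lift_eq]
    simp [sub_eq_add_neg]

/-- At the left end this is the stability of monomorphisms under weak pushouts. -/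
lemma weakCokernelUpToMono_revMap (hd : 1 ≤ d) {S : ComposableArrows C (d + 1)} (h : IsDExact S)
    (j : ℕ) : WeakCokernelUpToMono (revMap S (j + 1)) (revMap S j) := by
  rcases lt_trichotomy j d with hj | rfl | hj
  · exact h.2.weakCokernelUpToMono_revMap hj
  · intro W p _
    have := mono_revMap h.1.mono
    exact hM.exists_mono_of_mono hd _ p
  · rcases revMap_cases S hj with ⟨-, h⟩ | ⟨h, -⟩
    · exact fun W p hp => ⟨W, 𝟙 W, 0, inferInstance, by
        rw [comp_zero, (cancel_epi (revMap S (j + 1))).1 (hp.trans comp_zero.symm), zero_comp]⟩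
    · exact fun W p _ => ⟨W, 𝟙 W, inv (revMap S j) ≫ p, inferInstance, by simp⟩

/-- The resolution of the last morphism of a `d`-exact sequence by the remaining morphisms. -/
noncomputable def leftResolution (hd : 1 ≤ d) {S : ComposableArrows C (d + 1)} (h : IsDExact S) :
    LeftResolution (revMap S 0) where
  K j := revObj S (j + 2)
  D j := revMap S (j + 2)
  κ := revMap S 1
  κ_comp := h.2.revMap_comp 0
  D_comp_κ := h.2.revMap_comp 1
  D_comp_D j := h.2.revMap_comp (j + 2)
  weakKernel_κ := h.1.weakKernel_revMap 0
  weakKernel_zero := h.1.weakKernel_revMap 1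
  weakKernel_succ j := h.1.weakKernel_revMap (j + 2)
  weakCokernel_zero := hM.weakCokernelUpToMono_revMap hd h 1
  weakCokernel_succ j := hM.weakCokernelUpToMono_revMap hd h (j + 2)

section

variable {F : Cᵒᵖ ⥤ AddCommGrpCat.{w}}
  (hF : ∀ S : ComposableArrows C (d + 1), IsDExact S → IsLeftExactOn F S)

include hF

lemma injective_res_of_epi {A B : C} (f : A ⟶ B) [Epi f] : Function.Injective (res F f) :=
  hM.of_forall_isDExact_of_epi f (fun f => Function.Injective (res F f)) fun S hS => (hF S hS).1

lemma exists_leftResolution (hd : 1 ≤ d) {A B : C} (f : A ⟶ B) [Epi f] :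
    ∃ R : LeftResolution f, R.IsExactOn F d := by
  refine hM.of_forall_isDExact_of_epi f (fun f => ∃ R : LeftResolution f, R.IsExactOn F d)
    fun S hS => ?_
  have e : revMap S 0 = S.map' d (d + 1) := revMap_of_le S (Nat.zero_le d)
  rw [← e]
  exact ⟨hM.leftResolution hd hS, (hF S hS).resExact_revMap hd,
    fun h => (hF S hS).resExact_revMap h,
    fun j hj => (hF S hS).resExact_revMap hj⟩

/-- A functor which is exact on `d`-exact sequences is exact at the second place of each right
`d`-exact sequence. -/
lemma resExact_of_isRightDExact [F.Additive] (hd : 1 ≤ d) {S : ComposableArrows C (d + 1)}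
    (hS : IsRightDExact S) : ResExact F (S.map' 0 1) (S.map' 1 2) := by
  have := hM.hasFiniteBiproducts
  have := hasBinaryBiproducts_of_finite_biproducts C
  obtain ⟨k, rfl⟩ : ∃ k, d = k + 1 := ⟨d - 1, by lia⟩
  have key := resExact_of_weakCokernelUpToMono (F := F) (d := k + 1)
    (fun A B f _ => hM.injective_res_of_epi hF f)
    (fun A B f _ => hM.exists_leftResolution hF hd f) k (by lia) hS.revMap_comp hS.epi_revMap
    (fun j hj => hS.weakCokernelUpToMono_revMap (by lia))
  rw [revMap_of_le S le_rfl, revMap_of_le S (by lia)] at key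
  have (a b c : ℕ) (ha : a = 0) (hb : b = 1) (hc : c = 2)
      (h : ResExact F (S.map' a b) (S.map' b c)) :
      ResExact F (S.map' 0 1) (S.map' 1 2) := by
    subst ha hb hc
    exact h
  exact this _ _ _ (by lia) (by lia) (by lia) key

end

end IsDAbelian

end Reverse

section Criterion

variable {C : Type u} [Category.{v} C] [Preadditive C] {d : ℕ}

/-- An element of `F(Y)` which vanishes on `X` is the restriction of an element of some `F(Z)`
along a morphism `Y ⟶ Z` which vanishes on `X`: a relation satisfied by an element is explained by
a relation in `C`. -/
def IsEquationallyFlat (F : Cᵒᵖ ⥤ AddCommGrpCat.{w}) : Prop :=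
  ∀ ⦃X Y : C⦄ (f : X ⟶ Y) (a : F.obj (op Y)), res F f a = 0 →
    ∃ (Z : C) (g : Y ⟶ Z) (b : F.obj (op Z)), f ≫ g = 0 ∧ res F g b = a

lemma IsDAbelian.isEquationallyFlat (hM : IsDAbelian d C) (hd : 1 ≤ d) {F : Cᵒᵖ ⥤ AddCommGrpCat.{w}}
    (h : ∀ S : ComposableArrows C (d + 1), IsRightDExact S → ResExact F (S.map' 0 1) (S.map' 1 2)) :
    IsEquationallyFlat F := by
  intro X Y f
  refine hM.of_forall_isRightDExact f (fun {X Y} f => ∀ (a : F.obj (op Y)), res F f a = 0 →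
    ∃ (Z : C) (g : Y ⟶ Z) (b : F.obj (op Z)), f ≫ g = 0 ∧ res F g b = a) fun S hS a ha => ?_
  obtain ⟨b, hb⟩ := h S hS a ha
  exact ⟨_, S.map' 1 2, b, hS.map_comp rfl rfl (by lia), hb⟩

lemma IsEquationallyFlat.isLeftExactOn {F : Cᵒᵖ ⥤ AddCommGrpCat.{w}} [F.Additive]
    (hF : IsEquationallyFlat F) {S : ComposableArrows C (d + 1)} (hS : IsRightDExact S) :
    IsLeftExactOn F S := by
  refine ⟨(injective_iff_map_eq_zero (res F _)).2 fun a ha => ?_, fun k hk a =>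
    ⟨fun ha => ?_, ?_⟩⟩
  · obtain ⟨Z, g, b, hg, rfl⟩ := hF _ a ha
    have := hS.epi
    have hg₀ : g = 0 := (cancel_epi _).1 (hg.trans comp_zero.symm)
    rw [hg₀, res_zero]
  · obtain ⟨Z, g, b, hg, rfl⟩ := hF _ a ha
    obtain ⟨q, rfl⟩ := hS.exists_extension (a := k) rfl rfl (by lia) g hg
    exact ⟨res F q b, (res_comp F _ _ b).symm⟩
  · rintro ⟨b, rfl⟩
    change res F _ (res F _ b) = 0
    rw [← res_comp, hS.map_comp (a := k) rfl rfl (by lia), res_zero]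

end Criterion

/-! ### Filtered colimits of representable functors -/

section Elements

variable {C : Type u} [Category.{v} C]

/-- The category of elements of a contravariant functor `F`, with morphisms in the direction of
those of `C`: it is the category of representable functors over `F`. -/
structure Element (F : Cᵒᵖ ⥤ AddCommGrpCat.{w}) where
  /-- The object of `C` at which the element lives. -/
  X : C
  /-- The element. -/
  a : F.obj (op X)

namespace Element

variable {F : Cᵒᵖ ⥤ AddCommGrpCat.{w}}

instance : Category (Element F) where
  Hom x y := { f : x.X ⟶ y.X // res F f y.a = x.a }
  id x := ⟨𝟙 x.X, res_id F x.a⟩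
  comp f g := ⟨f.1 ≫ g.1, by rw [res_comp, g.2, f.2]⟩

/-- The projection from the category of elements of `F` to `C`. -/
@[simps]
def proj (F : Cᵒᵖ ⥤ AddCommGrpCat.{w}) : Element F ⥤ C where
  obj x := x.X
  map f := f.1

variable [Preadditive C]

section

variable [HasBinaryBiproducts C] [F.Additive] {X : C} (a b : F.obj (op X))

/-- The element `(a, b)` of `F(X ⊞ X)`, for elements `a` and `b` of `F(X)`. -/
noncomputable abbrev pair : Element F := ⟨X ⊞ X, res F biprod.fst a + res F biprod.snd b⟩

/-- The element `a` is the restriction of `(a, b)` along the first inclusion. -/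
noncomputable def inlHom : (⟨X, a⟩ : Element F) ⟶ pair a b :=
  ⟨biprod.inl, by simp [← res_comp]⟩

/-- The element `b` is the restriction of `(a, b)` along the second inclusion. -/
noncomputable def inrHom : (⟨X, b⟩ : Element F) ⟶ pair a b :=
  ⟨biprod.inr, by simp [← res_comp]⟩

/-- The element `a + b` is the restriction of `(a, b)` along the diagonal. -/
noncomputable def addHom : (⟨X, a + b⟩ : Element F) ⟶ pair a b :=
  ⟨biprod.inl + biprod.inr, by simp [← res_comp]⟩

end

lemma isFiltered [HasFiniteBiproducts C] [F.Additive] (hF : IsEquationallyFlat F) :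
    IsFiltered (Element F) where
  cocone_objs x y := by
    have := hasBinaryBiproducts_of_finite_biproducts C
    exact ⟨⟨x.X ⊞ y.X, res F biprod.fst x.a + res F biprod.snd y.a⟩,
      ⟨biprod.inl, by simp [← res_comp]⟩, ⟨biprod.inr, by simp [← res_comp]⟩, trivial⟩
  cocone_maps x y f g := by
    obtain ⟨Z, h, b, hh, hb⟩ := hF (f.1 - g.1) y.a (by rw [res_sub, f.2, g.2, sub_self])
    rw [Preadditive.sub_comp, sub_eq_zero] at hh
    exact ⟨⟨Z, b⟩, ⟨h, hb⟩, Subtype.ext hh⟩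
  nonempty := by
    obtain ⟨Z, -⟩ := (hasZeroObject_of_hasFiniteBiproducts C).zero
    exact ⟨⟨Z, 0⟩⟩

end Element

end Elements

section Ind

variable {C : Type u} [SmallCategory C] [Preadditive C]

/-- The Yoneda correspondence: the morphism from a representable functor to `F` given by an element
of `F`. -/
noncomputable def elementHom (F : Mod C) (x : Element F.obj) : (modYoneda C).obj x.X ⟶ F :=
  ObjectProperty.homMk
    { app := fun Y => AddCommGrpCat.ofHom
        { toFun := fun g => res F.obj (show Y.unop ⟶ x.X from g) x.a
          map_zero' := res_zero F.obj x.a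
          map_add' := fun g h => res_add F.obj _ _ x.a }
      naturality := fun Y Z f => by
        ext g
        exact res_comp F.obj f.unop (show Y.unop ⟶ x.X from g) x.a }

/-- The representable functors over `F`, with their morphisms to `F`. -/
noncomputable def elementCocone (F : Mod C) : Cocone (Element.proj F.obj ⋙ modYoneda C) where
  pt := F
  ι :=
    { app := fun x => elementHom F x
      naturality := fun x y f => by
        apply ObjectProperty.hom_ext
        ext Z g
        change res F.obj ((show Z.unop ⟶ x.X from g) ≫ f.1) y.a =
          res F.obj (show Z.unop ⟶ x.X from g) x.a
        rw [res_comp, f.2] }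

/-- The Yoneda correspondence: the element of `G` given by a morphism from a representable functor
to `G`. -/
noncomputable def homElement {G : Mod C} {X : C} (k : (modYoneda C).obj X ⟶ G) :
    G.obj.obj (op X) :=
  k.hom.app (op X) (𝟙 X)

lemma res_homElement {G : Mod C} {X Y : C} (k : (modYoneda C).obj Y ⟶ G) (f : X ⟶ Y) :
    res G.obj f (homElement k) = k.hom.app (op X) f := by
  have h : k.hom.app (op X) (f ≫ 𝟙 Y) = res G.obj f (homElement k) :=
    ConcreteCategory.congr_hom (k.hom.naturality f.op) (𝟙 Y)
  rw [← h, Category.comp_id]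

/-- The element of the point of a cocone given by its component at `x`. -/
noncomputable def coconeElement {F : Mod C} (s : Cocone (Element.proj F.obj ⋙ modYoneda C))
    (x : Element F.obj) : s.pt.obj.obj (op x.X) :=
  homElement (X := x.X) (s.ι.app x)

lemma res_coconeElement {F : Mod C} (s : Cocone (Element.proj F.obj ⋙ modYoneda C))
    {x y : Element F.obj} (f : x ⟶ y) :
    res s.pt.obj f.1 (coconeElement s y) = coconeElement s x := by
  refine (res_homElement (X := x.X) (Y := y.X) (s.ι.app y) f.1).trans ?_
  have h : (s.ι.app y).hom.app (op x.X) (show x.X ⟶ y.X from 𝟙 x.X ≫ f.1) = coconeElement s x :=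
    congrArg (fun k => k.hom.app (op x.X) (𝟙 x.X)) (s.w f)
  rwa [Category.id_comp] at h

lemma coconeElement_add [HasBinaryBiproducts C] {F : Mod C}
    (s : Cocone (Element.proj F.obj ⋙ modYoneda C)) {X : C} (a b : F.obj.obj (op X)) :
    coconeElement s ⟨X, a + b⟩ = coconeElement s ⟨X, a⟩ + coconeElement s ⟨X, b⟩ := by
  rw [← res_coconeElement s (Element.inlHom a b), ← res_coconeElement s (Element.inrHom a b),
    ← res_coconeElement s (Element.addHom a b)]
  exact res_add _ _ _ _

/-- Every functor is the colimit of the representable functors over it. -/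
noncomputable def isColimitElementCocone [HasBinaryBiproducts C] (F : Mod C) :
    IsColimit (elementCocone F) where
  desc s := ObjectProperty.homMk
    { app := fun Y => AddCommGrpCat.ofHom (AddMonoidHom.mk'
        (fun a => coconeElement s ⟨Y.unop, a⟩) (coconeElement_add s))
      naturality := fun Y Z f => by
        ext a
        exact (res_coconeElement s
          (⟨f.unop, rfl⟩ : (⟨Z.unop, res F.obj f.unop a⟩ : Element F.obj) ⟶ ⟨Y.unop, a⟩)).symm }
  fac s x := by
    apply ObjectProperty.hom_ext
    ext Z g
    refine (res_coconeElement s (⟨g, rfl⟩ :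
      (⟨Z.unop, res F.obj (show Z.unop ⟶ x.X from g) x.a⟩ : Element F.obj) ⟶ x)).symm.trans ?_
    exact res_homElement (X := Z.unop) (Y := x.X) (s.ι.app x) g
  uniq s m hm := by
    apply ObjectProperty.hom_ext
    ext Z (a : F.obj.obj (op Z.unop))
    have h := congrArg (fun k => k.hom.app Z (𝟙 Z.unop)) (hm ⟨Z.unop, a⟩)
    refine Eq.trans ?_ h
    exact congrArg (m.hom.app Z) (res_id F.obj a).symm

lemma IsEquationallyFlat.indCompletion [HasFiniteBiproducts C] {F : Mod C}
    (hF : IsEquationallyFlat F.obj) : indCompletion C F :=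
  ⟨Element F.obj, inferInstance, Element.isFiltered hF,
    ⟨_, (elementCocone F).ι,
      have := hasBinaryBiproducts_of_finite_biproducts C
      isColimitElementCocone F⟩,
    fun x => (modYoneda C).obj_mem_essImage x.X⟩

lemma isClosedUnderColimitsOfShape_additiveFunctor (J : Type u) [SmallCategory J] :
    (additiveFunctor Cᵒᵖ AddCommGrpCat.{u}).IsClosedUnderColimitsOfShape J where
  colimitsOfShape_le := by
    rintro F ⟨p⟩
    refine ⟨fun {X Y f g} => ?_⟩
    refine (isColimitOfPreserves ((evaluation _ _).obj X) p.isColimit).hom_ext fun j => ?_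
    have : (p.diag.obj j).Additive := p.prop_diag_obj j
    change (p.ι.app j).app X ≫ F.map (f + g) = (p.ι.app j).app X ≫ (F.map f + F.map g)
    have h (k : X ⟶ Y) : (p.ι.app j).app X ≫ F.map k = (p.diag.obj j).map k ≫ (p.ι.app j).app Y :=
      ((p.ι.app j).naturality k).symm
    rw [Preadditive.comp_add, h, h, h, Functor.map_add, Preadditive.add_comp]

lemma isEquationallyFlat_of_indCompletion {F : Mod C} (hF : indCompletion C F) :
    IsEquationallyFlat F.obj := by
  obtain ⟨J, _, _, pres, h⟩ := hF
  have := isClosedUnderColimitsOfShape_additiveFunctor (C := C) J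
  intro X Y f a ha
  -- Filtered colimits in `Mod C` are computed objectwise.
  let E (Y : C) := isColimitOfPreserves
    ((additiveFunctor Cᵒᵖ AddCommGrpCat.{u}).ι ⋙ (evaluation _ _).obj (op Y)) pres.isColimit
  obtain ⟨i, (x : (pres.diag.obj i).obj.obj (op Y)), hx⟩ := Concrete.isColimit_exists_rep _ (E Y) a
  change (pres.ι.app i).hom.app (op Y) x = a at hx
  have hι (i : J) {X Y : C} (f : X ⟶ Y) (x : (pres.diag.obj i).obj.obj (op Y)) :
      (pres.ι.app i).hom.app (op X) (res (pres.diag.obj i).obj f x) =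
        res F.obj f ((pres.ι.app i).hom.app (op Y) x) :=
    ConcreteCategory.congr_hom ((pres.ι.app i).hom.naturality f.op) x
  have hs {i j : J} (s : i ⟶ j) {X Y : C} (f : X ⟶ Y) (x : (pres.diag.obj i).obj.obj (op Y)) :
      (pres.diag.map s).hom.app (op X) (res (pres.diag.obj i).obj f x) =
        res (pres.diag.obj j).obj f ((pres.diag.map s).hom.app (op Y) x) :=
    ConcreteCategory.congr_hom ((pres.diag.map s).hom.naturality f.op) x
  obtain ⟨j, s, t, hst⟩ := Concrete.isColimit_exists_of_rep_eq _ (E X)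
    (i := i) (j := i) (res (pres.diag.obj i).obj f x) (0 : (pres.diag.obj i).obj.obj (op X)) (by
      change (pres.ι.app i).hom.app (op X) (res (pres.diag.obj i).obj f x) =
        (pres.ι.app i).hom.app (op X) 0
      rw [hι, hx, ha, map_zero])
  change (pres.diag.map s).hom.app (op X) (res (pres.diag.obj i).obj f x) =
    (pres.diag.map t).hom.app (op X) 0 at hst
  rw [hs, map_zero] at hst
  obtain ⟨Z, ⟨e⟩⟩ := h j
  have he : e.hom.hom ≫ e.inv.hom = 𝟙 _ := congrArg (fun k => k.hom) e.hom_inv_id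
  have he' : e.inv.hom ≫ e.hom.hom = 𝟙 _ := congrArg (fun k => k.hom) e.inv_hom_id
  have hinv {X Y : C} (f : X ⟶ Y) (x : (pres.diag.obj j).obj.obj (op Y)) :
      e.inv.hom.app (op X) (res (pres.diag.obj j).obj f x) =
        f ≫ (show Y ⟶ Z from e.inv.hom.app (op Y) x) :=
    ConcreteCategory.congr_hom (e.inv.hom.naturality f.op) x
  have hhom {X Y : C} (f : X ⟶ Y) (x : Y ⟶ Z) :
      e.hom.hom.app (op X) (f ≫ x) =
        res (pres.diag.obj j).obj f (e.hom.hom.app (op Y) x) :=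
    ConcreteCategory.congr_hom (e.hom.hom.naturality f.op) x
  let y : (pres.diag.obj j).obj.obj (op Y) := (pres.diag.map s).hom.app (op Y) x
  let g : Y ⟶ Z := e.inv.hom.app (op Y) y
  refine ⟨Z, g, (pres.ι.app j).hom.app (op Z) (e.hom.hom.app (op Z) (𝟙 Z)), ?_, ?_⟩
  · rw [← hinv, hst]
    exact map_zero _
  · have hy : e.hom.hom.app (op Y) g = y := ConcreteCategory.congr_hom
      (congrArg (fun k => k.app (op Y)) he') y
    rw [← hι, ← hhom, Category.comp_id, hy, ← hx]
    exact ConcreteCategory.congr_hom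
      (congrArg (fun k => k.hom.app (op Y)) (pres.ι.naturality s)) x

end Ind

/-! ### Flat functors -/

section Flat

variable {C : Type u} [SmallCategory C] [Preadditive C] {F : Mod C} {G : CoMod C}

/-- The element `a ⊗ x` of `F ⊗_C G`. -/
noncomputable def tensorMk (F : Mod C) (G : CoMod C) {X : C} (a : F.obj.obj (op X))
    (x : G.obj.obj X) : Tensor F G :=
  QuotientAddGroup.mk (TensorSum.tmul F G X a x)

lemma tensorMk_add_left {X : C} (a b : F.obj.obj (op X)) (x : G.obj.obj X) :
    tensorMk F G (a + b) x = tensorMk F G a x + tensorMk F G b x := by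
  classical
  rw [tensorMk, TensorSum.tmul, TensorProduct.add_tmul, map_add]
  rfl

lemma tensorMk_add_right {X : C} (a : F.obj.obj (op X)) (x y : G.obj.obj X) :
    tensorMk F G a (x + y) = tensorMk F G a x + tensorMk F G a y := by
  classical
  rw [tensorMk, TensorSum.tmul, TensorProduct.tmul_add, map_add]
  rfl

lemma tensorMk_zero_left {X : C} (x : G.obj.obj X) :
    tensorMk F G (0 : F.obj.obj (op X)) x = 0 := by
  simpa using tensorMk_add_left (F := F) (G := G) 0 0 x

lemma tensorMk_zero_right {X : C} (a : F.obj.obj (op X)) :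
    tensorMk F G a (0 : G.obj.obj X) = 0 := by
  simpa using tensorMk_add_right (F := F) (G := G) a 0 0

lemma tensorMk_res {X Y : C} (f : X ⟶ Y) (a : F.obj.obj (op Y)) (x : G.obj.obj X) :
    tensorMk F G (res F.obj f a) x = tensorMk F G a (G.obj.map f x) :=
  (QuotientAddGroup.eq_iff_sub_mem).2 (AddSubgroup.subset_closure ⟨X, Y, f, a, x, rfl⟩)

lemma tensorMap_tensorMk {G' : CoMod C} (g : G ⟶ G') {X : C} (a : F.obj.obj (op X))
    (x : G.obj.obj X) :
    tensorMap F g (tensorMk F G a x) = tensorMk F G' a (g.hom.app X x) :=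
  congrArg QuotientAddGroup.mk (tensorSumMap_tmul F g X a x)

/-- The universal property of `F ⊗_C G`. -/
lemma exists_tensorLift {A : Type w} [AddCommGroup A]
    (φ : ∀ X : C, F.obj.obj (op X) →+ G.obj.obj X →+ A)
    (hφ : ∀ ⦃X Y : C⦄ (f : X ⟶ Y) (a : F.obj.obj (op Y)) (x : G.obj.obj X),
      φ X (res F.obj f a) x = φ Y a (G.obj.map f x)) :
    ∃ Φ : Tensor F G →+ A, ∀ (X : C) (a : F.obj.obj (op X)) (x : G.obj.obj X),
      Φ (tensorMk F G a x) = φ X a x := by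
  classical
  let ψ : TensorSum F G →+ A := DirectSum.toAddMonoid fun X =>
    TensorProduct.liftAddHom (φ X) fun r a x => by simp
  have hψ (X : C) (a : F.obj.obj (op X)) (x : G.obj.obj X) :
      ψ (TensorSum.tmul F G X a x) = φ X a x := by
    unfold TensorSum.tmul
    refine (DirectSum.toAddMonoid_of _ _ _).trans ?_
    rfl
  refine ⟨QuotientAddGroup.lift _ ψ ((AddSubgroup.closure_le _).2 ?_), hψ⟩
  rintro _ ⟨X, Y, f, a, x, rfl⟩
  change ψ _ = 0
  rw [map_sub, hψ, hψ, sub_eq_zero]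
  exact hφ f a x

lemma exists_tensorMk [HasFiniteBiproducts C] (t : Tensor F G) :
    ∃ (X : C) (a : F.obj.obj (op X)) (x : G.obj.obj X), t = tensorMk F G a x := by
  classical
  have := hasBinaryBiproducts_of_finite_biproducts C
  have hadd : ∀ t₁ t₂ : Tensor F G,
      (∃ (X : C) (a : F.obj.obj (op X)) (x : G.obj.obj X), t₁ = tensorMk F G a x) →
      (∃ (X : C) (a : F.obj.obj (op X)) (x : G.obj.obj X), t₂ = tensorMk F G a x) →
      ∃ (X : C) (a : F.obj.obj (op X)) (x : G.obj.obj X), t₁ + t₂ = tensorMk F G a x := by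
    rintro _ _ ⟨X, a, x, rfl⟩ ⟨Y, b, y, rfl⟩
    refine ⟨X ⊞ Y, res F.obj biprod.fst a + res F.obj biprod.snd b,
      G.obj.map biprod.inl x + G.obj.map biprod.inr y, ?_⟩
    rw [tensorMk_add_left, tensorMk_res, tensorMk_res, map_add, map_add,
      ← ConcreteCategory.comp_apply,
      ← ConcreteCategory.comp_apply, ← ConcreteCategory.comp_apply, ← ConcreteCategory.comp_apply,
      ← Functor.map_comp, ← Functor.map_comp, ← Functor.map_comp, ← Functor.map_comp]
    simp
  have hzero : ∃ (X : C) (a : F.obj.obj (op X)) (x : G.obj.obj X),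
      (0 : Tensor F G) = tensorMk F G a x := by
    obtain ⟨Z, -⟩ := (hasZeroObject_of_hasFiniteBiproducts C).zero
    exact ⟨Z, 0, 0, (tensorMk_zero_left _).symm⟩
  obtain ⟨t, rfl⟩ := QuotientAddGroup.mk_surjective t
  induction t using DirectSum.induction_on with
  | zero => exact hzero
  | of X t =>
    induction t using TensorProduct.induction_on with
    | zero => rw [map_zero]; exact hzero
    | tmul a x => exact ⟨X, a, x, rfl⟩
    | add t₁ t₂ h₁ h₂ => rw [map_add]; exact hadd _ _ h₁ h₂
  | add t₁ t₂ h₁ h₂ => exact hadd _ _ h₁ h₂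

/-- If the category of elements of `F` is filtered, `F ⊗_C G` is the colimit of the `G(X)` over
it, which says when an element `a ⊗ x` vanishes. -/
lemma IsEquationallyFlat.exists_of_tensorMk_eq_zero [HasFiniteBiproducts C]
    (hF : IsEquationallyFlat F.obj) {X : C} {a : F.obj.obj (op X)} {x : G.obj.obj X}
    (h : tensorMk F G a x = 0) :
    ∃ (Z : C) (g : X ⟶ Z) (b : F.obj.obj (op Z)), res F.obj g b = a ∧ G.obj.map g x = 0 := by
  have := hasBinaryBiproducts_of_finite_biproducts C
  have := Element.isFiltered hF
  let H : Element F.obj ⥤ AddCommGrpCat.{u} := Element.proj F.obj ⋙ G.obj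
  let ι (x : Element F.obj) : G.obj.obj x.X →+ (colimit H : AddCommGrpCat.{u}) :=
    (colimit.ι H x).hom
  have hι {x y : Element F.obj} (f : x ⟶ y) (z : G.obj.obj x.X) :
      ι x z = ι y (G.obj.map f.1 z) :=
    (ConcreteCategory.congr_hom (colimit.w H f) z).symm
  obtain ⟨Φ, hΦ⟩ := exists_tensorLift (F := F) (G := G)
    (fun X => AddMonoidHom.mk' (fun a => ι ⟨X, a⟩) fun a b => by
      ext z
      rw [AddMonoidHom.add_apply, hι (Element.addHom a b), hι (Element.inlHom a b),
        hι (Element.inrHom a b), ← map_add]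
      exact congrArg (ι _) (DFunLike.congr_fun (congrArg AddCommGrpCat.Hom.hom
        (G.obj.map_add (f := biprod.inl) (g := biprod.inr))) z))
    (fun X Y f a x =>
      hι (⟨f, rfl⟩ : (⟨X, res F.obj f a⟩ : Element F.obj) ⟶ ⟨Y, a⟩) x)
  have h₀ : ι ⟨X, a⟩ x = ι ⟨X, a⟩ 0 := by
    rw [map_zero]
    exact (hΦ X a x).symm.trans (by rw [h, map_zero])
  obtain ⟨y, s, t, hst⟩ := Concrete.colimit_exists_of_rep_eq H _ _ h₀
  refine ⟨y.X, s.1, y.a, s.2, ?_⟩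
  exact hst.trans (map_zero (G.obj.map t.1).hom)

lemma IsEquationallyFlat.flatFunctors [HasFiniteBiproducts C]
    (hF : IsEquationallyFlat F.obj) : flatFunctors C F := by
  intro G₁ G₂ G₃ g h hgh t
  constructor
  · intro ht
    obtain ⟨X, a, x, rfl⟩ := exists_tensorMk t
    rw [tensorMap_tensorMk] at ht
    obtain ⟨Z, k, b, rfl, hk⟩ := hF.exists_of_tensorMk_eq_zero ht
    have e : h.hom.app Z (G₂.obj.map k x) = 0 :=
      (ConcreteCategory.congr_hom (h.hom.naturality k) x).trans hk
    obtain ⟨y, hy⟩ := (hgh Z _).1 e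
    exact ⟨tensorMk F G₁ b y, by rw [tensorMap_tensorMk, hy, tensorMk_res]⟩
  · rintro ⟨s, rfl⟩
    obtain ⟨X, a, x, rfl⟩ := exists_tensorMk s
    rw [tensorMap_tensorMk, tensorMap_tensorMk, (hgh X _).2 ⟨x, rfl⟩, tensorMk_zero_right]

/-- The covariant functor represented by `X`. -/
noncomputable def corepresentable (X : C) : CoMod C :=
  AdditiveFunctor.of (preadditiveCoyoneda.obj (op X))

/-- The universal element of the covariant functor represented by `X`. -/
def corepresentableId (X : C) : (corepresentable X).obj.obj X :=
  𝟙 X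

/-- The morphism of representable functors induced by `f : X ⟶ Y`. -/
noncomputable def corepresentableMap {X Y : C} (f : X ⟶ Y) :
    corepresentable Y ⟶ corepresentable X :=
  ObjectProperty.homMk (preadditiveCoyoneda.map f.op)

/-- The morphisms from `Y` which vanish on `X`, for `f : X ⟶ Y`, as a functor of the target. -/
noncomputable def annihilator {X Y : C} (f : X ⟶ Y) : CoMod C where
  obj :=
    { obj := fun Z => AddCommGrpCat.of (Preadditive.leftComp Z f).ker
      map := fun {Z W} k => AddCommGrpCat.ofHom
        (AddMonoidHom.mk' (fun g => ⟨g.1 ≫ k, by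
            have := g.2
            rw [AddMonoidHom.mem_ker] at this ⊢
            change f ≫ g.1 = 0 at this
            change f ≫ g.1 ≫ k = 0
            rw [← Category.assoc, this, zero_comp]⟩)
          fun g h => Subtype.ext (Preadditive.add_comp _ _ _ _ _ _))
      map_id := fun Z => by
        ext g
        exact Category.comp_id _
      map_comp := fun k l => by
        ext g
        exact (Category.assoc _ _ _).symm }
  property := ⟨fun {Z W k l} => by
    ext g
    exact Preadditive.comp_add _ _ _ _ _ _⟩

/-- The inclusion of the annihilator of `f : X ⟶ Y` into the functor represented by `Y`. -/
noncomputable def annihilatorHom {X Y : C} (f : X ⟶ Y) : annihilator f ⟶ corepresentable Y :=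
  ObjectProperty.homMk
    { app := fun Z => AddCommGrpCat.ofHom (Preadditive.leftComp Z f).ker.subtype
      naturality := fun _ _ _ => rfl }

lemma isEquationallyFlat_of_flatFunctors [HasFiniteBiproducts C] (hF : flatFunctors C F) :
    IsEquationallyFlat F.obj := by
  intro X Y f a ha
  -- `F ⊗_C -` is exact on the sequence `annihilator f ⟶ Hom(Y, -) ⟶ Hom(X, -)`.
  have hex := hF (annihilatorHom f) (corepresentableMap f) fun Z (g : Y ⟶ Z) =>
    ⟨fun (hg : f ≫ g = 0) => ⟨⟨g, hg⟩, rfl⟩, by rintro ⟨k, rfl⟩; exact k.2⟩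
  obtain ⟨s, hs⟩ := (hex (tensorMk F (corepresentable Y) a (corepresentableId Y))).1 (by
    have e : (corepresentableMap f).hom.app Y (corepresentableId Y) =
        (corepresentable X).obj.map f (corepresentableId X) :=
      (Category.comp_id f).trans (Category.id_comp f).symm
    rw [tensorMap_tensorMk, e, ← tensorMk_res, ha, tensorMk_zero_left])
  obtain ⟨Z, b, k, rfl⟩ := exists_tensorMk s
  rw [tensorMap_tensorMk] at hs
  -- The evaluation `F ⊗_C Hom(Y, -) → F(Y)`.
  obtain ⟨Φ, hΦ⟩ := exists_tensorLift (F := F) (G := corepresentable Y)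
    (fun X => AddMonoidHom.flip (AddMonoidHom.mk' (fun g : Y ⟶ X => res F.obj g)
      fun g h => by ext b; exact res_add F.obj g h b))
    (fun X Z k b g => (res_comp F.obj (show Y ⟶ X from g) k b).symm)
  exact ⟨Z, k.1, b, k.2, (hΦ _ _ _).symm.trans ((congrArg Φ hs).trans
    ((hΦ _ _ _).trans (res_id F.obj a)))⟩

end Flat

end DAbelian

theorem proposition3p3 {M : Type u} [SmallCategory M] [Preadditive M] (d : ℕ) (hd : 1 ≤ d)
    (hM : DAbelian.IsDAbelian d M) :
    DAbelian.indCompletion M = DAbelian.leftDExactFunctors M d ∧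
      DAbelian.indCompletion M = DAbelian.flatFunctors M ∧
      DAbelian.leftDExactFunctors M d = DAbelian.leftExactOnDExact M d := by
  have := hM.hasFiniteBiproducts
  have hInd (F : DAbelian.Mod M) :
      DAbelian.indCompletion M F ↔ DAbelian.IsEquationallyFlat F.obj :=
    ⟨DAbelian.isEquationallyFlat_of_indCompletion, fun h => h.indCompletion⟩
  have hFlat (F : DAbelian.Mod M) :
      DAbelian.flatFunctors M F ↔ DAbelian.IsEquationallyFlat F.obj :=
    ⟨fun h => DAbelian.isEquationallyFlat_of_flatFunctors h, fun h => h.flatFunctors⟩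
  have hL (F : DAbelian.Mod M) :
      DAbelian.leftDExactFunctors M d F ↔ DAbelian.IsEquationallyFlat F.obj :=
    ⟨fun h => hM.isEquationallyFlat hd fun S hS => (h S hS).resExact rfl rfl (by lia),
      fun h _ hS => h.isLeftExactOn hS⟩
  have hD (F : DAbelian.Mod M) :
      DAbelian.leftExactOnDExact M d F ↔ DAbelian.IsEquationallyFlat F.obj :=
    ⟨fun h => hM.isEquationallyFlat hd fun _ hS => hM.resExact_of_isRightDExact h hd hS,
      fun h _ hS => h.isLeftExactOn hS.2⟩
  refine ⟨?_, ?_, ?_⟩ <;> ext F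
  · rw [hInd, hL]
  · rw [hInd, hFlat]
  · rw [hL, hD]
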